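/- **Theorem 3.3.** Let $\mathbf E^3_1$ be $\mathbb R^3$ with the metric $\langle\,,\rangle=dx_1^2+dx_2^2-dx_3^2$, let $|a|=\sqrt{|\langle a,a\rangle|}$ and $E_3=(0,0,1)$. For timelike vectors $a,b$ with $\langle a,b\rangle<0$ the hyperbolic angle between $a$ and $b$ is the unique $\theta\ge 0$ with $\langle a,b\rangle=-|a||b|\cosh\theta$. Let $M$ be a smooth surface, let $x:M\to\mathbf E^3_1$ be a smooth spacelike immersion (the induced metric is Riemannian) with smooth unit normal field $\xi$, and suppose that $M$ is a constant angle surface: there is a fixed timelike vector $U$ such that, at every point of $M$, the hyperbolic angle between $\xi$ and $U$ is defined and equals a constant $\theta$. Suppose that $M$ is not totally geodesic, that is, its second fundamental form $\sigma$ (the normal part of the ambient covariant derivative) does not vanish identically. Then $\theta>0$, and there is a rigid motion $F$ of $\mathbf E^3_1$ whose linear part $L$ satisfies $L(U)=|U|\,E_3$, so that $F\circ x$ is a constant angle spacelike surface whose unit normal $L\circ\xi$ makes the constant hyperbolic angle $\theta$ with $E_3$, and such that the following holds around every point $p\in M$ with $\sigma_p\neq 0$. There are local coordinates $(u,v)$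 of $M$ on a neighbourhood of $p$, ranging over an open rectangle $J\times I\subset\mathbb R^2$, a smooth function $\alpha:I\to\mathbb R$, and functions $\psi_1,\psi_2:I\to\mathbb R$ with $$\psi_1'(v)=\sinh\theta\,\alpha(v)\sin v,\qquad \psi_2'(v)=-\sinh\theta\,\alpha(v)\cos v\qquad(v\in I),$$ such that on this neighbourhood $$F(x(u,v))=\bigl(u\cosh\theta\cos v+\psi_1(v),\;u\cosh\theta\sin v+\psi_2(v),\;-u\sinh\theta\bigr).$$ -/

import Mathlib

open scoped Manifold ContDiff

namespace Minkowski

/-- The underlying vector space of Minkowski 3-space (only its linear and smooth structure are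
used; the metric is `mink`). -/
abbrev E31 : Type := Fin 3 → ℝ

/-- The Lorentzian metric `dx₁² + dx₂² - dx₃²`. -/
def mink (a b : E31) : ℝ := a 0 * b 0 + a 1 * b 1 - a 2 * b 2

/-- The Minkowski length `|a| = √|⟨a, a⟩|`. -/
noncomputable def minkNorm (a : E31) : ℝ := Real.sqrt |mink a a|

/-- The vector `(0, 0, 1)`. -/
def E3 : E31 := ![0, 0, 1]

/-- `a` is timelike. -/
def IsTimelike (a : E31) : Prop := mink a a < 0

/-- `θ` is the hyperbolic angle between `a` and `b`: both vectors are timelike, they lie in the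
same timelike cone, `θ ≥ 0`, and `⟨a, b⟩ = -|a| |b| cosh θ`. -/
def IsHyperbolicAngle (a b : E31) (θ : ℝ) : Prop :=
  IsTimelike a ∧ IsTimelike b ∧ mink a b < 0 ∧ 0 ≤ θ ∧
    mink a b = -(minkNorm a * minkNorm b * Real.cosh θ)

/-- A rigid motion of Minkowski 3-space: an affine map whose linear part preserves the Lorentzian
metric and the orientation. -/
def IsRigidMotion (F : E31 →ᵃ[ℝ] E31) : Prop :=
  (∀ a b, mink (F.linear a) (F.linear b) = mink a b) ∧ LinearMap.det F.linear = 1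

section Surface

variable {M : Type*} [TopologicalSpace M] [ChartedSpace (EuclideanSpace ℝ (Fin 2)) M]

/-- The differential of a map from a surface to Minkowski space. -/
noncomputable def diff (x : M → E31) (p : M) : TangentSpace (𝓡 2) p →L[ℝ] E31 :=
  mfderiv (𝓡 2) 𝓘(ℝ, E31) x p

/-- A smooth spacelike immersion: the induced metric is positive definite on every tangent plane
(in particular the differential is injective). -/
def IsSpacelikeImmersion (x : M → E31) : Prop :=
  ContMDiff (𝓡 2) 𝓘(ℝ, E31) ∞ x ∧
    ∀ (p : M) (w : TangentSpace (𝓡 2) p), w ≠ 0 → 0 < mink (diff x p w) (diff x p w)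

/-- A (smooth) unit normal vector field along a spacelike immersion. -/
def IsUnitNormalField (x ξ : M → E31) : Prop :=
  ContMDiff (𝓡 2) 𝓘(ℝ, E31) ∞ ξ ∧ (∀ p, mink (ξ p) (ξ p) = -1) ∧
    ∀ (p : M) (w : TangentSpace (𝓡 2) p), mink (ξ p) (diff x p w) = 0

/-- `x` is a constant angle spacelike surface: its unit normal field `ξ` makes the constant
hyperbolic angle `θ` with the fixed timelike vector `U`. -/
def IsConstantAngleSurface (x ξ : M → E31) (U : E31) (θ : ℝ) : Prop :=
  IsSpacelikeImmersion x ∧ IsUnitNormalField x ξ ∧ IsTimelike U ∧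
    ∀ p, IsHyperbolicAngle (ξ p) U θ

/-- A smooth tangent vector field on the surface. -/
def IsSmoothField [IsManifold (𝓡 2) ∞ M] (X : (p : M) → TangentSpace (𝓡 2) p) : Prop :=
  ContMDiff (𝓡 2) (𝓡 2).tangent ∞ fun p => (⟨p, X p⟩ : TangentBundle (𝓡 2) M)

/-- The ambient covariant derivative of `Y` in the direction `X` at `p`, that is, the derivative
in the direction `X p` of the vector field `q ↦ dx (Y q)` along `x`. -/
noncomputable def ambientDeriv (x : M → E31) (X Y : (p : M) → TangentSpace (𝓡 2) p) (p : M) :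
    E31 :=
  diff (fun q => diff x q (Y q)) p (X p)

/-- The second fundamental form `σ(X, Y)` at `p`: the normal part of the ambient covariant
derivative of `Y` along `X`. As `⟨ξ, ξ⟩ = -1`, the normal part of `a` is `-⟨a, ξ⟩ ξ`. -/
noncomputable def secondFundamentalForm (x ξ : M → E31)
    (X Y : (p : M) → TangentSpace (𝓡 2) p) (p : M) : E31 :=
  -(mink (ambientDeriv x X Y p) (ξ p)) • ξ p

/-- The second fundamental form vanishes at `p`. -/
def IsTotallyGeodesicAt [IsManifold (𝓡 2) ∞ M] (x ξ : M → E31) (p : M) : Prop :=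
  ∀ X Y : (q : M) → TangentSpace (𝓡 2) q, IsSmoothField X → IsSmoothField Y →
    secondFundamentalForm x ξ X Y p = 0

/-- The surface is totally geodesic: its second fundamental form vanishes identically. -/
def IsTotallyGeodesic [IsManifold (𝓡 2) ∞ M] (x ξ : M → E31) : Prop :=
  ∀ p, IsTotallyGeodesicAt x ξ p

end Surface

/-- The parametrization `(u cosh θ (cos v, sin v) + ψ(v), -u sinh θ)`. -/
noncomputable def param (θ : ℝ) (ψ₁ ψ₂ : ℝ → ℝ) (u v : ℝ) : E31 :=
  ![u * Real.cosh θ * Real.cos v + ψ₁ v,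
    u * Real.cosh θ * Real.sin v + ψ₂ v,
    -(u * Real.sinh θ)]

end Minkowski

/-! A proper Lorentz isometry takes `U` to a multiple of `E3`, so the third coordinate of the unit
normal is `cosh θ` and its horizontal part has length `sinh θ`. If `θ = 0` the normal is constant
and `σ = 0`; hence `θ > 0`, and locally the normal is `normalDir θ v` for a smooth angle `v`
(`exists_angle`).

Where `σ ≠ 0` the derivative of the normal, hence `dv`, is nonzero
(`isTotallyGeodesicAt_of_diff_eq_zero`). Put `u = -x₃ / sinh θ`. A vector killed by `du` and `dv`
has horizontal image, orthogonal to the normal and, by symmetry of the shape operator, to the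
derivative of the normal; so it is zero. Thus `(u, v)` are local coordinates
(`exists_height_angle`), over a rectangle by the inverse function theorem.

In these coordinates let `h` and `k` be the components of the horizontal part of `x` along `(cos v,
sin v)` and `(-sin v, cos v)`. Orthogonality to the normal reads `dh = cosh θ du + k dv`, so `h = u
cosh θ + h₀(v)` and `k = h₀'(v)`, which is the normal form with `α = -(h₀ + h₀'') / sinh θ`
(`exists_param`). -/

namespace Minkowski

/-! ### Differentiating the metric; symmetry of the shape operator. -/

section Planar

variable {E : Type*} [NormedAddCommGroup E] [NormedSpace ℝ E]

theorem fderiv_mink {f g : E → E31} {z : E} (hf : DifferentiableAt ℝ f z)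
    (hg : DifferentiableAt ℝ g z) (w : E) :
    fderiv ℝ (fun z => mink (f z) (g z)) z w =
      mink (fderiv ℝ f z w) (g z) + mink (f z) (fderiv ℝ g z w) := by
  have hfi := hasFDerivAt_pi'.1 hf.hasFDerivAt
  have hgi := hasFDerivAt_pi'.1 hg.hasFDerivAt
  have h := (((hfi 0).mul (hgi 0)).add ((hfi 1).mul (hgi 1))).sub ((hfi 2).mul (hgi 2))
  have h' : HasFDerivAt (fun z => mink (f z) (g z)) _ z := h
  rw [h'.fderiv]
  simp [mink]
  ring

/-- The shape operator of a hypersurface with normal field `N` is symmetric. -/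
theorem mink_fderiv_normal_comm {O : Set E} (hO : IsOpen O) {X N : E → E31}
    (hX : ContDiffOn ℝ ∞ X O) (hN : ContDiffOn ℝ ∞ N O)
    (horth : ∀ z ∈ O, ∀ w, mink (N z) (fderiv ℝ X z w) = 0) {z : E} (hz : z ∈ O) (w w' : E) :
    mink (fderiv ℝ N z w') (fderiv ℝ X z w) = mink (fderiv ℝ N z w) (fderiv ℝ X z w') := by
  have hXz : ContDiffAt ℝ ∞ X z := hX.contDiffAt (hO.mem_nhds hz)
  have hNd : DifferentiableAt ℝ N z :=
    (hN.contDiffAt (hO.mem_nhds hz)).differentiableAt (by simp)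
  have hXd : DifferentiableAt ℝ (fderiv ℝ X) z :=
    (hXz.fderiv_right (m := 1) (by norm_cast)).differentiableAt (by simp)
  -- Differentiating `⟨N, dX a⟩ = 0` along `b`; the claim then follows from the symmetry of the
  -- second derivative of `X`.
  have key (a b : E) : mink (fderiv ℝ N z b) (fderiv ℝ X z a) +
      mink (N z) (fderiv ℝ (fderiv ℝ X) z b a) = 0 := by
    have h0 : (fun y => mink (N y) (fderiv ℝ X y a)) =ᶠ[nhds z] fun _ => 0 := by
      filter_upwards [hO.mem_nhds hz] with y hy using horth y hy a
    have h1 := fderiv_mink hNd (hXd.clm_apply (differentiableAt_const a)) b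
    rw [h0.fderiv_eq, fderiv_clm_apply hXd (differentiableAt_const a)] at h1
    simpa using h1.symm
  have hs : IsSymmSndFDerivAt ℝ X z := hXz.isSymmSndFDerivAt (by
    rw [minSmoothness_of_isRCLikeNormedField]
    exact WithTop.coe_le_coe.2 (le_top : (2 : ℕ∞) ≤ ⊤))
  have h1 := key w w'
  have h2 := key w' w
  rw [hs.eq w w'] at h2
  linarith

end Planar

/-! ### The angle of the normal, and height-angle coordinates. -/

/-- The unit normal of the constant angle surfaces in normal form. -/
noncomputable def normalDir (θ v : ℝ) : E31 :=
  ![-(Real.sinh θ * Real.cos v), -(Real.sinh θ * Real.sin v), Real.cosh θ]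

theorem hasDerivAt_normalDir (θ v : ℝ) :
    HasDerivAt (normalDir θ) ![Real.sinh θ * Real.sin v, -(Real.sinh θ * Real.cos v), 0] v := by
  rw [hasDerivAt_pi]
  intro i
  fin_cases i
  · simpa [normalDir] using ((Real.hasDerivAt_cos v).const_mul (Real.sinh θ)).fun_neg
  · simpa [normalDir] using ((Real.hasDerivAt_sin v).const_mul (Real.sinh θ)).fun_neg
  · simpa [normalDir] using hasDerivAt_const v (Real.cosh θ)

theorem exists_cos_sin_eq {a b : ℝ} (h : a ^ 2 + b ^ 2 = 1) :
    ∃ v, Real.cos v = a ∧ Real.sin v = b := by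
  have hn : ‖(⟨a, b⟩ : ℂ)‖ = 1 := by
    rw [Complex.norm_def, Complex.normSq_mk, ← sq, ← sq, h, Real.sqrt_one]
  refine ⟨Complex.arg ⟨a, b⟩, ?_, ?_⟩
  · rw [Complex.cos_arg (by rw [← norm_pos_iff, hn]; exact one_pos), hn, div_one]
  · rw [Complex.sin_arg, hn, div_one]

/-- Near a point, a smooth unit field of constant angle with `E3` is `normalDir θ` of a smooth
angle function. -/
theorem exists_angle {E : Type*} [NormedAddCommGroup E] [NormedSpace ℝ E] {O : Set E}
    (hO : IsOpen O) {N : E → E31} (hN : ContDiffOn ℝ ∞ N O) {θ : ℝ} (hθ : 0 < θ)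
    (hunit : ∀ z ∈ O, mink (N z) (N z) = -1) (hang : ∀ z ∈ O, N z 2 = Real.cosh θ)
    {z₀ : E} (hz₀ : z₀ ∈ O) :
    ∃ O' ⊆ O, IsOpen O' ∧ z₀ ∈ O' ∧ ∃ v : E → ℝ, ContDiffOn ℝ ∞ v O' ∧
      ∀ z ∈ O', N z = normalDir θ (v z) := by
  have hs : 0 < Real.sinh θ := Real.sinh_pos_iff.2 hθ
  have hcs := Real.cosh_sq θ
  have hsq : ∀ z ∈ O, N z 0 ^ 2 + N z 1 ^ 2 = Real.sinh θ ^ 2 := by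
    intro z hz
    have h1 := hunit z hz
    rw [mink, hang z hz] at h1
    linarith
  obtain ⟨v₀, hc0, hs0⟩ := exists_cos_sin_eq (a := -N z₀ 0 / Real.sinh θ)
    (b := -N z₀ 1 / Real.sinh θ) (by
      have := hsq z₀ hz₀
      field_simp
      linarith)
  have hNi := contDiffOn_pi.1 hN
  -- `c` and `s` are the cosine and sine of the angle measured from its value `v₀` at `z₀`. Since `c
  -- z₀ = 1`, near `z₀` one has `c > 0`, and there `arcsin s` is a smooth branch of the angle.
  set c : E → ℝ := fun z => -(N z 0 * Real.cos v₀ + N z 1 * Real.sin v₀) / Real.sinh θ with hc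
  set s : E → ℝ := fun z => (N z 0 * Real.sin v₀ - N z 1 * Real.cos v₀) / Real.sinh θ with hsdef
  have hcd : ContDiffOn ℝ ∞ c O := by
    exact (((hNi 0).mul contDiffOn_const).add ((hNi 1).mul contDiffOn_const)).neg.div_const _
  have hsd : ContDiffOn ℝ ∞ s O := by
    exact (((hNi 0).mul contDiffOn_const).sub ((hNi 1).mul contDiffOn_const)).div_const _
  have hcs1 : ∀ z ∈ O, s z ^ 2 + c z ^ 2 = 1 := by
    intro z hz
    have h1 := hsq z hz
    have h2 := Real.sin_sq_add_cos_sq v₀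
    simp only [hc, hsdef]
    field_simp
    linear_combination h1 + (N z 0 ^ 2 + N z 1 ^ 2) * h2
  refine ⟨O ∩ c ⁻¹' Set.Ioi 0, Set.inter_subset_left,
    hcd.continuousOn.isOpen_inter_preimage hO isOpen_Ioi, ⟨hz₀, ?_⟩,
    fun z => v₀ + Real.arcsin (s z), ?_, ?_⟩
  · have : c z₀ = 1 := by
      have h1 := hsq z₀ hz₀
      simp only [hc, hc0, hs0]
      field_simp
      linarith
    simp [this]
  · intro z hz
    have h1 := hcs1 z hz.1
    have h2 : 0 < c z := hz.2
    have h3 : 0 < c z ^ 2 := by positivity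
    have hsz : ContDiffAt ℝ ∞ s z := hsd.contDiffAt (hO.mem_nhds hz.1)
    have := Real.contDiffAt_arcsin (n := ∞) (x := s z) (by rintro h; rw [h] at h1; linarith)
      (by rintro h; rw [h] at h1; linarith)
    exact (contDiffAt_const.add (this.comp z hsz)).contDiffWithinAt
  · intro z hz
    have h1 := hcs1 z hz.1
    have h2 : 0 < c z := hz.2
    have hsin : Real.sin (Real.arcsin (s z)) = s z :=
      Real.sin_arcsin (by nlinarith [sq_nonneg (c z)]) (by nlinarith [sq_nonneg (c z)])
    have hcos : Real.cos (Real.arcsin (s z)) = c z := by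
      rw [Real.cos_arcsin, show 1 - s z ^ 2 = c z ^ 2 by linarith, Real.sqrt_sq h2.le]
    have h3 := Real.sin_sq_add_cos_sq v₀
    ext i
    fin_cases i
    · simp only [normalDir, Real.cos_add, hsin, hcos]
      simp only [hc, hsdef]
      simp
      field_simp
      linear_combination (-N z 0) * h3
    · simp only [normalDir, Real.sin_add, hsin, hcos]
      simp only [hc, hsdef]
      simp
      field_simp
      linear_combination (-N z 1) * h3
    · simpa [normalDir] using hang z hz.1

/-- The height and the angle of the normal are local coordinates of a constant angle surface
where its normal field has non-zero derivative. -/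
theorem exists_height_angle {O : Set (EuclideanSpace ℝ (Fin 2))}
    (hO : IsOpen O) {X N : EuclideanSpace ℝ (Fin 2) → E31} (hX : ContDiffOn ℝ ∞ X O)
    (hN : ContDiffOn ℝ ∞ N O) {θ : ℝ} (hθ : 0 < θ)
    (hunit : ∀ z ∈ O, mink (N z) (N z) = -1) (hang : ∀ z ∈ O, N z 2 = Real.cosh θ)
    (horth : ∀ z ∈ O, ∀ w, mink (N z) (fderiv ℝ X z w) = 0)
    {z₀ : EuclideanSpace ℝ (Fin 2)} (hz₀ : z₀ ∈ O)
    (hpos : ∀ w, w ≠ 0 → 0 < mink (fderiv ℝ X z₀ w) (fderiv ℝ X z₀ w))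
    (hne : fderiv ℝ N z₀ ≠ 0) :
    ∃ O' ⊆ O, IsOpen O' ∧ z₀ ∈ O' ∧
      ∃ G : EuclideanSpace ℝ (Fin 2) → EuclideanSpace ℝ (Fin 2), ContDiffOn ℝ ∞ G O' ∧
        Function.Injective (fderiv ℝ G z₀) ∧
        ∀ z ∈ O', X z 2 = -(G z 0 * Real.sinh θ) ∧ N z = normalDir θ (G z 1) := by
  have hs : 0 < Real.sinh θ := Real.sinh_pos_iff.2 hθ
  obtain ⟨O', hO'O, hO', hz₀', v, hv, hNv⟩ := exists_angle hO hN hθ hunit hang hz₀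
  have hX2 := contDiffOn_pi.1 (hX.mono hO'O) 2
  set G : EuclideanSpace ℝ (Fin 2) → EuclideanSpace ℝ (Fin 2) :=
    fun z => !₂[-(X z 2) / Real.sinh θ, v z] with hG
  have hGd : ContDiffOn ℝ ∞ G O' := by
    rw [contDiffOn_euclidean]
    intro i
    fin_cases i
    · simpa [hG] using hX2.neg.div_const _
    · simpa [hG] using hv
  refine ⟨O', hO'O, hO', hz₀', G, hGd, ?_, fun z hz => ⟨?_, ?_⟩⟩
  · have hmem := hO'.mem_nhds hz₀'
    have hXd : DifferentiableAt ℝ X z₀ :=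
      (hX.contDiffAt (hO.mem_nhds hz₀)).differentiableAt (by simp)
    have hvd : DifferentiableAt ℝ v z₀ := (hv.contDiffAt hmem).differentiableAt (by simp)
    have hGd' : DifferentiableAt ℝ G z₀ := (hGd.contDiffAt hmem).differentiableAt (by simp)
    have hGi (i : Fin 2) : HasFDerivAt (fun z => G z i)
        ((EuclideanSpace.proj (𝕜 := ℝ) i).comp (fderiv ℝ G z₀)) z₀ :=
      (EuclideanSpace.proj (𝕜 := ℝ) i).hasFDerivAt.comp z₀ hGd'.hasFDerivAt
    have hX2d : HasFDerivAt (fun z => X z 2)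
        ((ContinuousLinearMap.proj (R := ℝ) (φ := fun _ : Fin 3 => ℝ) 2).comp (fderiv ℝ X z₀)) z₀ :=
      hasFDerivAt_pi'.1 hXd.hasFDerivAt 2
    have hDN : fderiv ℝ N z₀ = (fderiv ℝ v z₀).smulRight
        ![Real.sinh θ * Real.sin (v z₀), -(Real.sinh θ * Real.cos (v z₀)), 0] := by
      have h1 : N =ᶠ[nhds z₀] normalDir θ ∘ v := by
        filter_upwards [hmem] with z hz using hNv z hz
      rw [h1.fderiv_eq]
      have := (hasDerivAt_normalDir θ (v z₀)).hasFDerivAt.comp z₀ hvd.hasFDerivAt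
      rw [this.fderiv]
      ext w i
      simp
    rw [injective_iff_map_eq_zero]
    intro w hw
    have hw0 : fderiv ℝ X z₀ w 2 = 0 := by
      have h1 := hX2d.fun_neg.mul_const (Real.sinh θ)⁻¹
      have h2 := congrArg (fun L => L w) ((hGi 0).unique h1)
      simpa [hw, hs.ne'] using h2
    have hw1 : fderiv ℝ v z₀ w = 0 := by
      have h1 : HasFDerivAt (fun z => G z 1) (fderiv ℝ v z₀) z₀ := hvd.hasFDerivAt
      have h2 := congrArg (fun L => L w) ((hGi 1).unique h1)
      simpa [hw] using h2.symm
    -- Pairing `w` with such a `w'` in the symmetry of the shape operator makes the image of `w`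
    -- orthogonal to `(sin v, -cos v, 0)`.
    obtain ⟨w', hw'⟩ : ∃ w', fderiv ℝ v z₀ w' ≠ 0 := by
      by_contra! h
      apply hne
      rw [hDN]
      ext w' i
      simp [h w']
    have hsym := mink_fderiv_normal_comm hO hX hN horth hz₀ w w'
    have ho := horth z₀ hz₀ w
    rw [hNv z₀ hz₀'] at ho
    simp [hDN, hw1, mink, hw0] at hsym
    simp [normalDir, mink, hw0] at ho
    have h1 : fderiv ℝ X z₀ w 0 * Real.sin (v z₀) - fderiv ℝ X z₀ w 1 * Real.cos (v z₀) = 0 := by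
      apply mul_left_cancel₀ (mul_ne_zero hw' hs.ne')
      linear_combination hsym
    have h2 : fderiv ℝ X z₀ w 0 * Real.cos (v z₀) + fderiv ℝ X z₀ w 1 * Real.sin (v z₀) = 0 := by
      apply mul_left_cancel₀ hs.ne'
      linear_combination -ho
    have h3 := Real.sin_sq_add_cos_sq (v z₀)
    by_contra hw
    have h4 := hpos w hw
    rw [mink, hw0] at h4
    -- The squared length of a horizontal vector is the sum of the squares of its components in the
    -- rotated frame, which vanish by `h1` and `h2`.
    have h5 : fderiv ℝ X z₀ w 0 * fderiv ℝ X z₀ w 0 + fderiv ℝ X z₀ w 1 * fderiv ℝ X z₀ w 1 = 0 := by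
      linear_combination (fderiv ℝ X z₀ w 0 * Real.sin (v z₀) - fderiv ℝ X z₀ w 1 * Real.cos (v z₀)) * h1
        + (fderiv ℝ X z₀ w 0 * Real.cos (v z₀) + fderiv ℝ X z₀ w 1 * Real.sin (v z₀)) * h2
        - (fderiv ℝ X z₀ w 0 ^ 2 + fderiv ℝ X z₀ w 1 ^ 2) * h3
    linarith
  · simp [hG, hs.ne']
  · simpa [hG] using hNv z hz

/-! ### Normal form over a rectangle, and the inverse function theorem. -/

/-- The open coordinate rectangle `J × I` with `J = (c, d)`, `I = (a, b)`. -/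
def rect (a b c d : ℝ) : Set (EuclideanSpace ℝ (Fin 2)) :=
  {y | y 0 ∈ Set.Ioo c d ∧ y 1 ∈ Set.Ioo a b}

theorem isOpen_rect (a b c d : ℝ) : IsOpen (rect a b c d) :=
  (isOpen_Ioo.preimage (EuclideanSpace.proj (𝕜 := ℝ) (0 : Fin 2)).continuous).inter
    (isOpen_Ioo.preimage (EuclideanSpace.proj (𝕜 := ℝ) (1 : Fin 2)).continuous)

theorem hasDerivAt_toLp_pair {f g : ℝ → ℝ} {f' g' t : ℝ} (hf : HasDerivAt f f' t)
    (hg : HasDerivAt g g' t) :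
    HasDerivAt (fun t => (!₂[f t, g t] : EuclideanSpace ℝ (Fin 2))) !₂[f', g'] t := by
  have h : HasDerivAt (fun t => ![f t, g t]) ![f', g'] t := by
    rw [hasDerivAt_pi]
    intro i
    fin_cases i
    · simpa using hf
    · simpa using hg
  exact (EuclideanSpace.equiv (Fin 2) ℝ).symm.hasFDerivAt.comp_hasDerivAt t h

/-- A surface over a rectangle, parametrized by its height and the angle of its normal, is in
normal form. -/
theorem exists_param {a b c d θ : ℝ} (hθ : 0 < θ) (hcd : c < d)
    {Y : EuclideanSpace ℝ (Fin 2) → E31} (hY : ContDiffOn ℝ ∞ Y (rect a b c d))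
    (hY2 : ∀ y ∈ rect a b c d, Y y 2 = -(y 0 * Real.sinh θ))
    (horth : ∀ y ∈ rect a b c d, ∀ w, mink (normalDir θ (y 1)) (fderiv ℝ Y y w) = 0) :
    ∃ α ψ₁ ψ₂ : ℝ → ℝ, ContDiffOn ℝ ∞ α (Set.Ioo a b) ∧
      (∀ v ∈ Set.Ioo a b,
        HasDerivAt ψ₁ (Real.sinh θ * (α v * Real.sin v)) v ∧
        HasDerivAt ψ₂ (Real.sinh θ * -(α v * Real.cos v)) v) ∧
      ∀ y ∈ rect a b c d, Y y = param θ ψ₁ ψ₂ (y 0) (y 1) := by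
  have hs : 0 < Real.sinh θ := Real.sinh_pos_iff.2 hθ
  set h : EuclideanSpace ℝ (Fin 2) → ℝ :=
    fun y => Y y 0 * Real.cos (y 1) + Y y 1 * Real.sin (y 1) with hdef
  set k : EuclideanSpace ℝ (Fin 2) → ℝ :=
    fun y => Y y 1 * Real.cos (y 1) - Y y 0 * Real.sin (y 1) with kdef
  have hp (i : Fin 2) (y) : HasFDerivAt (fun y : EuclideanSpace ℝ (Fin 2) => y i)
      (EuclideanSpace.proj (𝕜 := ℝ) i) y := (EuclideanSpace.proj (𝕜 := ℝ) i).hasFDerivAt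
  -- Orthogonality to the normal turns `cos v dY₀ + sin v dY₁` into `cosh θ du`; differentiating
  -- `cos v` and `sin v` contributes `k dv`.
  have hh : ∀ y ∈ rect a b c d, HasFDerivAt h (Real.cosh θ • EuclideanSpace.proj (𝕜 := ℝ) 0 +
      k y • EuclideanSpace.proj (𝕜 := ℝ) 1) y := by
    intro y hy
    have hmem := (isOpen_rect a b c d).mem_nhds hy
    have hYd : DifferentiableAt ℝ Y y := (hY.contDiffAt hmem).differentiableAt (by simp)
    have hYi := hasFDerivAt_pi'.1 hYd.hasFDerivAt
    have h2 : (fun z => Y z 2) =ᶠ[nhds y] fun z => -(z 0 * Real.sinh θ) := by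
      filter_upwards [hmem] with z hz using hY2 z hz
    have h2' := ((hp 0 y).mul_const (Real.sinh θ)).neg.congr_of_eventuallyEq h2
    have h3 := (hYi 2).unique h2'
    have h4 := ((hYi 0).mul ((Real.hasDerivAt_cos (y 1)).comp_hasFDerivAt y (hp 1 y))).add
      ((hYi 1).mul ((Real.hasDerivAt_sin (y 1)).comp_hasFDerivAt y (hp 1 y)))
    refine h4.congr_fderiv ?_
    ext w
    have h5 := congrArg (fun L => L w) h3
    have h6 := horth y hy w
    simp at h5
    simp [mink, normalDir, h5] at h6
    simp [kdef]
    apply mul_left_cancel₀ hs.ne'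
    linear_combination -h6
  set u₀ := (c + d) / 2 with hu₀
  have hu : u₀ ∈ Set.Ioo c d := ⟨by linarith, by linarith⟩
  have hmemr : ∀ {u v}, u ∈ Set.Ioo c d → v ∈ Set.Ioo a b → !₂[u, v] ∈ rect a b c d :=
    fun h1 h2 => ⟨by simpa using h1, by simpa using h2⟩
  have hcurve (v : ℝ) : HasDerivAt (fun v => (!₂[u₀, v] : EuclideanSpace ℝ (Fin 2)))
      !₂[0, 1] v := by
    exact hasDerivAt_toLp_pair (hasDerivAt_const v u₀) (hasDerivAt_id v)
  have hcurve' (u v : ℝ) : HasDerivAt (fun u => (!₂[u, v] : EuclideanSpace ℝ (Fin 2)))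
      !₂[1, 0] u := by
    exact hasDerivAt_toLp_pair (hasDerivAt_id u) (hasDerivAt_const u v)
  -- The part of `h` depending on `v` alone, read off on the line `u = u₀`; any `u₀` in the interval
  -- would serve.
  set h₀ : ℝ → ℝ := fun v => h !₂[u₀, v] - Real.cosh θ * u₀ with h₀def
  set k₀ : ℝ → ℝ := fun v => k !₂[u₀, v] with k₀def
  have hh₀ : ∀ v ∈ Set.Ioo a b, HasDerivAt h₀ (k₀ v) v := by
    intro v hv
    have := ((hh _ (hmemr hu hv)).comp_hasDerivAt v (hcurve v)).sub_const (Real.cosh θ * u₀)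
    simpa [h₀def, k₀def, Function.comp_def] using this
  have hsplit : ∀ y ∈ rect a b c d, h y = h₀ (y 1) + Real.cosh θ * y 0 := by
    intro y hy
    have hder : ∀ u ∈ Set.Ioo c d,
        HasDerivAt (fun u => h !₂[u, y 1] - Real.cosh θ * u) 0 u := by
      intro u hu'
      have := ((hh _ (hmemr hu' hy.2)).comp_hasDerivAt u (hcurve' u (y 1))).sub
        ((hasDerivAt_id u).const_mul (Real.cosh θ))
      exact this.congr_deriv (by simp)
    have := isOpen_Ioo.is_const_of_deriv_eq_zero isPreconnected_Ioo
      (fun u hu' => (hder u hu').differentiableAt.differentiableWithinAt)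
      (fun u hu' => (hder u hu').deriv) hy.1 hu
    have hyy : (!₂[y 0, y 1] : EuclideanSpace ℝ (Fin 2)) = y := by
      ext i; fin_cases i <;> simp
    simp only [hyy] at this
    simp only [h₀def]
    linarith
  -- Comparing the `dv`-coefficients of the two expressions for `dh`.
  have hk : ∀ y ∈ rect a b c d, k y = k₀ (y 1) := by
    intro y hy
    have hmem := (isOpen_rect a b c d).mem_nhds hy
    have h1 : h =ᶠ[nhds y] fun y => h₀ (y 1) + Real.cosh θ * y 0 := by
      filter_upwards [hmem] with z hz using hsplit z hz
    have h2 := (((hh₀ (y 1) hy.2).comp_hasFDerivAt y (hp 1 y)).add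
      ((hp 0 y).const_mul (Real.cosh θ))).congr_of_eventuallyEq h1
    have := congrArg (fun L => L !₂[0, 1]) ((hh y hy).unique h2)
    simpa using this
  have hYu : ContDiffOn ℝ ∞ (fun v => Y !₂[u₀, v]) (Set.Ioo a b) := by
    have : ContDiff ℝ ∞ (fun v => (!₂[u₀, v] : EuclideanSpace ℝ (Fin 2))) := by
      rw [contDiff_euclidean]
      intro i
      fin_cases i
      · simpa using contDiff_const
      · simpa using contDiff_fun_id
    exact hY.comp this.contDiffOn fun v hv => hmemr hu hv
  have hYui := contDiffOn_pi.1 hYu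
  have hk₀s : ContDiffOn ℝ ∞ k₀ (Set.Ioo a b) := by
    simpa [k₀def, kdef] using ((hYui 1).mul Real.contDiff_cos.contDiffOn).sub
      ((hYui 0).mul Real.contDiff_sin.contDiffOn)
  have hh₀s : ContDiffOn ℝ ∞ h₀ (Set.Ioo a b) := by
    simpa [h₀def, hdef] using (((hYui 0).mul Real.contDiff_cos.contDiffOn).add
      ((hYui 1).mul Real.contDiff_sin.contDiffOn)).sub contDiffOn_const
  -- The `ψ`s are the vector with components `h₀, k₀` in the rotating frame. As `h₀' = k₀`, the
  -- terms in `k₀` cancel in their derivatives, leaving `-(h₀ + k₀') (sin v, -cos v)`.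
  refine ⟨fun v => -(h₀ v + deriv k₀ v) / Real.sinh θ,
    fun v => h₀ v * Real.cos v - k₀ v * Real.sin v,
    fun v => h₀ v * Real.sin v + k₀ v * Real.cos v, ?_, fun v hv => ?_, fun y hy => ?_⟩
  · exact (hh₀s.add (hk₀s.deriv_of_isOpen isOpen_Ioo (by simp))).neg.div_const _
  · have hkd : HasDerivAt k₀ (deriv k₀ v) v :=
      ((hk₀s.contDiffAt (isOpen_Ioo.mem_nhds hv)).differentiableAt (by simp)).hasDerivAt
    constructor
    · refine HasDerivAt.congr_deriv
        (((hh₀ v hv).mul (Real.hasDerivAt_cos v)).sub (hkd.mul (Real.hasDerivAt_sin v))) ?_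
      field_simp
      ring
    · refine HasDerivAt.congr_deriv
        (((hh₀ v hv).mul (Real.hasDerivAt_sin v)).add (hkd.mul (Real.hasDerivAt_cos v))) ?_
      field_simp
      ring
  · have h1 := hsplit y hy
    have h2 := hk y hy
    have h3 := Real.sin_sq_add_cos_sq (y 1)
    simp only [hdef] at h1
    simp only [kdef] at h2
    ext i
    fin_cases i
    · simp [param]
      linear_combination Real.cos (y 1) * h1 - Real.sin (y 1) * h2 - Y y 0 * h3
    · simp [param]
      linear_combination Real.sin (y 1) * h1 + Real.cos (y 1) * h2 - Y y 1 * h3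
    · simpa [param] using hY2 y hy

theorem exists_rect_subset {S : Set (EuclideanSpace ℝ (Fin 2))} (hS : IsOpen S)
    {y₀ : EuclideanSpace ℝ (Fin 2)} (hy₀ : y₀ ∈ S) :
    ∃ a b c d : ℝ, y₀ ∈ rect a b c d ∧ rect a b c d ⊆ S := by
  obtain ⟨r, hr, hrS⟩ := Metric.isOpen_iff.1 hS y₀ hy₀
  refine ⟨y₀ 1 - r / 2, y₀ 1 + r / 2, y₀ 0 - r / 2, y₀ 0 + r / 2, ?_, fun y hy => hrS ?_⟩
  · refine ⟨⟨?_, ?_⟩, ?_, ?_⟩ <;> linarith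
  · obtain ⟨⟨h1, h2⟩, h3, h4⟩ := hy
    rw [Metric.mem_ball, EuclideanSpace.dist_eq, Fin.sum_univ_two, Real.sqrt_lt' hr,
      Real.dist_eq, Real.dist_eq, sq_abs, sq_abs]
    nlinarith

/-- The inverse function theorem, with a rectangle as image. -/
theorem exists_openPartialHomeomorph_rect {O : Set (EuclideanSpace ℝ (Fin 2))} (hO : IsOpen O)
    {G : EuclideanSpace ℝ (Fin 2) → EuclideanSpace ℝ (Fin 2)} (hG : ContDiffOn ℝ ∞ G O)
    {z₀ : EuclideanSpace ℝ (Fin 2)} (hz₀ : z₀ ∈ O) (hinj : Function.Injective (fderiv ℝ G z₀)) :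
    ∃ ε : OpenPartialHomeomorph (EuclideanSpace ℝ (Fin 2)) (EuclideanSpace ℝ (Fin 2)),
      z₀ ∈ ε.source ∧ ε.source ⊆ O ∧ (∀ z, ε z = G z) ∧
      (∃ a b c d : ℝ, ε.target = rect a b c d) ∧
      ContDiffOn ℝ ∞ ε ε.source ∧ ContDiffOn ℝ ∞ ε.symm ε.target := by
  have hmem := hO.mem_nhds hz₀
  have hGz := hG.contDiffAt hmem
  let A : EuclideanSpace ℝ (Fin 2) ≃L[ℝ] EuclideanSpace ℝ (Fin 2) :=
    (LinearEquiv.ofInjectiveEndo (fderiv ℝ G z₀ : EuclideanSpace ℝ (Fin 2) →ₗ[ℝ] _)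
      hinj).toContinuousLinearEquiv
  have hA : (A : EuclideanSpace ℝ (Fin 2) →L[ℝ] EuclideanSpace ℝ (Fin 2)) = fderiv ℝ G z₀ := by
    ext w : 1
    rfl
  have hGd : HasFDerivAt G (A : EuclideanSpace ℝ (Fin 2) →L[ℝ] EuclideanSpace ℝ (Fin 2)) z₀ := by
    rw [hA]
    exact (hGz.differentiableAt (by simp)).hasFDerivAt
  let ε₀ := hGz.toOpenPartialHomeomorph G hGd (by simp)
  have hcont : ContinuousOn (fderiv ℝ G) O := hG.continuousOn_fderiv_of_isOpen hO (by simp)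
  -- Restricting to points where the derivative is invertible makes the inverse smooth on the whole
  -- target, not only at the image of `z₀`.
  let S : Set (EuclideanSpace ℝ (Fin 2)) := O ∩ fderiv ℝ G ⁻¹' Set.range
    ((↑) : (EuclideanSpace ℝ (Fin 2) ≃L[ℝ] EuclideanSpace ℝ (Fin 2)) →
      (EuclideanSpace ℝ (Fin 2) →L[ℝ] EuclideanSpace ℝ (Fin 2)))
  have hS : IsOpen S := hcont.isOpen_inter_preimage hO ContinuousLinearEquiv.isOpen
  have hz₀S : z₀ ∈ S := ⟨hz₀, A, hA⟩
  let ε₁ := ε₀.restrOpen S hS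
  have hz₁ : z₀ ∈ ε₁.source :=
    ⟨hGz.mem_toOpenPartialHomeomorph_source hGd (by simp), hz₀S⟩
  obtain ⟨a, b, c, d, hR, hRt⟩ := exists_rect_subset ε₁.open_target (ε₁.map_source hz₁)
  let ε := (ε₁.symm.restrOpen (rect a b c d) (isOpen_rect a b c d)).symm
  have htar : ε.target = rect a b c d := by
    change ε₁.target ∩ rect a b c d = rect a b c d
    exact Set.inter_eq_right.2 hRt
  have hG' : ∀ z, ε z = G z := fun z => rfl
  have hsrc : ε.source ⊆ ε₁.source := by
    intro z hz
    have h1 := ε.map_source hz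
    have h2 := ε.left_inv hz
    rw [htar] at h1
    rw [← h2]
    exact ε₁.map_target (hRt h1)
  have hsO : ε.source ⊆ O := fun z hz => (hsrc hz).2.1
  refine ⟨ε, ?_, hsO, hG', ⟨a, b, c, d, htar⟩, ?_, ?_⟩
  · have h1 : G z₀ ∈ ε.target := htar ▸ hR
    have h2 := ε.map_target h1
    have h3 : ε.symm (G z₀) = z₀ := ε₁.left_inv hz₁
    rwa [h3] at h2
  · exact (hG.mono hsO).congr fun z _ => hG' z
  · intro y hy
    have hz := ε.map_target hy
    obtain ⟨B, hB⟩ := (hsrc hz).2.2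
    have hGy : ContDiffAt ℝ ∞ G (ε.symm y) := hG.contDiffAt (hO.mem_nhds (hsO hz))
    refine (ε.contDiffAt_symm (f₀' := B) hy ?_ hGy).contDiffWithinAt
    rw [hB]
    exact (hGy.differentiableAt (by simp)).hasFDerivAt

/-! ### Reading maps of the surface in charts. -/

section Surface

variable {M : Type*} [TopologicalSpace M] [ChartedSpace (EuclideanSpace ℝ (Fin 2)) M]

/-- The tangent space at `p` is identified with the model plane through the preferred chart at `p`,
so the same `w` serves on both sides. At other points or in other charts a change of vector is
needed, as in `fderiv_comp_symm`. -/
theorem diff_apply_eq_fderiv {f : M → E31} {p : M} (hf : MDifferentiableAt (𝓡 2) 𝓘(ℝ, E31) f p)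
    (w : EuclideanSpace ℝ (Fin 2)) :
    diff f p w = fderiv ℝ (f ∘ (chartAt (EuclideanSpace ℝ (Fin 2)) p).symm)
      (chartAt (EuclideanSpace ℝ (Fin 2)) p p) w := by
  rw [diff, hf.mfderiv]
  simp [writtenInExtChartAt, mfld_simps, fderivWithin_univ]
  rfl

theorem contDiffOn_comp_symm {e : OpenPartialHomeomorph M (EuclideanSpace ℝ (Fin 2))}
    (he : e ∈ IsManifold.maximalAtlas (𝓡 2) ∞ M) {f : M → E31}
    (hf : ContMDiff (𝓡 2) 𝓘(ℝ, E31) ∞ f) : ContDiffOn ℝ ∞ (f ∘ e.symm) e.target := by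
  rw [← contMDiffOn_iff_contDiffOn]
  exact hf.comp_contMDiffOn (contMDiffOn_symm_of_mem_maximalAtlas he)

/-- The chain rule for a map read in a chart. -/
theorem fderiv_comp_symm {e : OpenPartialHomeomorph M (EuclideanSpace ℝ (Fin 2))}
    (he : e ∈ IsManifold.maximalAtlas (𝓡 2) ∞ M) {f : M → E31}
    (hf : ContMDiff (𝓡 2) 𝓘(ℝ, E31) ∞ f) {z : EuclideanSpace ℝ (Fin 2)} (hz : z ∈ e.target)
    (w : EuclideanSpace ℝ (Fin 2)) :
    ∃ w' : TangentSpace (𝓡 2) (e.symm z), fderiv ℝ (f ∘ e.symm) z w = diff f (e.symm z) w' := by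
  have h1 : MDifferentiableAt (𝓡 2) (𝓡 2) e.symm z :=
    (contMDiffAt_symm_of_mem_maximalAtlas he hz).mdifferentiableAt (by simp)
  have h2 : MDifferentiableAt (𝓡 2) 𝓘(ℝ, E31) f (e.symm z) :=
    (hf _).mdifferentiableAt (by simp)
  refine ⟨mfderiv (𝓡 2) (𝓡 2) e.symm z w, ?_⟩
  have h3 := mfderiv_comp z h2 h1
  rw [mfderiv_eq_fderiv] at h3
  rw [h3]
  rfl

end Surface

/-! ### Lorentz isometries moving the axis to `E3`. -/

section Isometry

/-- A half-turn about `n + E3` swaps `n` and `E3` and has determinant 1. It degenerates only when `n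
+ E3` is null, that is for `n = -E3`, where a half-turn about a horizontal axis does the job. Time
orientation need not be preserved. -/
theorem exists_isometry_of_unit {n : E31} (hn : mink n n = -1) :
    ∃ L : E31 →ₗ[ℝ] E31, (∀ a b, mink (L a) (L b) = mink a b) ∧ LinearMap.det L = 1 ∧
      L n = E3 := by
  rw [mink] at hn
  by_cases h : n 2 = -1
  · rw [h] at hn
    have h0 : n 0 = 0 := by nlinarith [sq_nonneg (n 0), sq_nonneg (n 1)]
    have h1 : n 1 = 0 := by nlinarith [sq_nonneg (n 0), sq_nonneg (n 1)]
    refine ⟨Matrix.toLin' !![1, 0, 0; 0, -1, 0; 0, 0, -1], fun a b => ?_, ?_, ?_⟩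
    · simp [mink, Matrix.mulVec, dotProduct, Fin.sum_univ_three]
    · rw [LinearMap.det_toLin', Matrix.det_fin_three]
      simp
    · ext i
      fin_cases i <;> simp [E3, Matrix.mulVec, dotProduct, Fin.sum_univ_three, h, h0, h1]
  · have h' : 1 + n 2 ≠ 0 := fun h'' => h (by linarith)
    set r := (1 + n 2)⁻¹ with hr
    have hr1 : r * (1 + n 2) = 1 := inv_mul_cancel₀ h'
    have hq : r * (n 0 ^ 2 + n 1 ^ 2) = n 2 - 1 := by
      apply mul_right_cancel₀ h'
      linear_combination (n 0 ^ 2 + n 1 ^ 2) * hr1 + hn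
    have hT : 2 * r + r ^ 2 * (n 0 ^ 2 + n 1 ^ 2) - 1 = 0 := by linear_combination r * hq + hr1
    -- the half-turn about the axis `n + E3`
    refine ⟨Matrix.toLin' !![-1 - r * n 0 * n 0, -(r * n 0 * n 1), n 0;
      -(r * n 0 * n 1), -1 - r * n 1 * n 1, n 1; -n 0, -n 1, n 2], fun a b => ?_, ?_, ?_⟩
    · simp [mink, Matrix.mulVec, dotProduct, Fin.sum_univ_three]
      linear_combination hT * (n 0 * a 0 + n 1 * a 1) * (n 0 * b 0 + n 1 * b 1) -
        hq * ((n 0 * a 0 + n 1 * a 1) * b 2 + (n 0 * b 0 + n 1 * b 1) * a 2) + hn * a 2 * b 2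
    · rw [LinearMap.det_toLin', Matrix.det_fin_three]
      simp
      linear_combination n 2 * hq - hn
    · ext i
      fin_cases i
      · simp [E3, Matrix.mulVec, dotProduct, Fin.sum_univ_three]
        linear_combination -n 0 * hq
      · simp [E3, Matrix.mulVec, dotProduct, Fin.sum_univ_three]
        linear_combination -n 1 * hq
      · simp [E3, Matrix.mulVec, dotProduct, Fin.sum_univ_three]
        linear_combination -hn

theorem mink_smul_left (t : ℝ) (a b : E31) : mink (t • a) b = t * mink a b := by
  simp [mink]
  ring

theorem mink_smul_right (t : ℝ) (a b : E31) : mink a (t • b) = t * mink a b := by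
  simp [mink]
  ring

theorem minkNorm_pos {U : E31} (hU : IsTimelike U) : 0 < minkNorm U :=
  Real.sqrt_pos.2 (abs_pos.2 hU.ne)

theorem minkNorm_sq {U : E31} (hU : IsTimelike U) : minkNorm U ^ 2 = -mink U U := by
  rw [minkNorm, Real.sq_sqrt (abs_nonneg _), abs_of_neg hU]

theorem exists_isometry {U : E31} (hU : IsTimelike U) :
    ∃ L : E31 →ₗ[ℝ] E31, (∀ a b, mink (L a) (L b) = mink a b) ∧ LinearMap.det L = 1 ∧
      L U = minkNorm U • E3 := by
  have hpos := minkNorm_pos hU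
  obtain ⟨L, hL, hdet, hLn⟩ := exists_isometry_of_unit (n := (minkNorm U)⁻¹ • U) (by
    rw [mink_smul_left, mink_smul_right]
    have := minkNorm_sq hU
    field_simp
    linarith)
  refine ⟨L, hL, hdet, ?_⟩
  rw [← hLn, ← map_smul, smul_inv_smul₀ hpos.ne']

/-- The metric is nondegenerate, so a vector in the kernel, being orthogonal to everything, is zero.
-/
theorem injective_of_mink {L : E31 →ₗ[ℝ] E31} (hL : ∀ a b, mink (L a) (L b) = mink a b) :
    Function.Injective L := by
  rw [injective_iff_map_eq_zero]
  intro a ha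
  have h (b : E31) : mink a b = 0 := by
    rw [← hL a b, ha]
    simp [mink]
  ext i
  fin_cases i
  · simpa [mink] using h ![1, 0, 0]
  · simpa [mink] using h ![0, 1, 0]
  · simpa [mink] using h ![0, 0, 1]

theorem minkNorm_of_unit {a : E31} (ha : mink a a = -1) : minkNorm a = 1 := by
  simp [minkNorm, ha]

theorem mink_E3 (a : E31) : mink a E3 = -a 2 := by
  simp [mink, E3]

/-- A unit timelike vector at zero hyperbolic angle from `U` is `U / |U|`. -/
theorem eq_smul_of_isHyperbolicAngle_zero {a U : E31} (ha : mink a a = -1)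
    (h : IsHyperbolicAngle a U 0) : a = (minkNorm U)⁻¹ • U := by
  obtain ⟨-, hU, -, -, hm⟩ := h
  obtain ⟨L, hL, -, hLU⟩ := exists_isometry hU
  have hpos := minkNorm_pos hU
  apply injective_of_mink hL
  rw [map_smul, hLU, inv_smul_smul₀ hpos.ne']
  rw [minkNorm_of_unit ha, Real.cosh_zero, ← hL, hLU, mink_smul_right, mink_E3] at hm
  have h2 : L a 2 = 1 := by
    apply mul_left_cancel₀ hpos.ne'
    linarith
  have h1 := hL a a
  rw [ha, mink, h2] at h1
  have h3 : L a 0 = 0 := by nlinarith [sq_nonneg (L a 0), sq_nonneg (L a 1)]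
  have h4 : L a 1 = 0 := by nlinarith [sq_nonneg (L a 0), sq_nonneg (L a 1)]
  ext i
  fin_cases i <;> simp [E3, h2, h3, h4]

end Isometry

/-! ### From the plane back to the surface. -/

section Surface

variable {M : Type*} [TopologicalSpace M] [ChartedSpace (EuclideanSpace ℝ (Fin 2)) M]

theorem diff_continuousLinearMap_comp {f : M → E31} {p : M}
    (hf : MDifferentiableAt (𝓡 2) 𝓘(ℝ, E31) f p) (L : E31 →L[ℝ] E31) (w : TangentSpace (𝓡 2) p) :
    diff (fun q => L (f q)) p w = L (diff f p w) := by
  have h : HasMFDerivAt (𝓡 2) 𝓘(ℝ, E31) (L ∘ f) p _ :=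
    (L.hasMFDerivAt (x := f p)).comp p hf.hasMFDerivAt
  change mfderiv (𝓡 2) 𝓘(ℝ, E31) (L ∘ f) p w = _
  rw [h.mfderiv]
  rfl

/-- Isometries preserve constant angle surfaces. -/
theorem IsConstantAngleSurface.isometry_comp {x ξ : M → E31} {U : E31} {θ : ℝ}
    (h : IsConstantAngleSurface x ξ U θ) {L : E31 →ₗ[ℝ] E31}
    (hL : ∀ a b, mink (L a) (L b) = mink a b) (hLU : L U = minkNorm U • E3) :
    IsConstantAngleSurface (fun q => L (x q)) (fun q => L (ξ q)) E3 θ := by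
  obtain ⟨⟨hx, himm⟩, ⟨hξ, hunit, horth⟩, hU, hang⟩ := h
  have hE3 : mink E3 E3 = -1 := by simp [mink, E3]
  have hLs : ContMDiff 𝓘(ℝ, E31) 𝓘(ℝ, E31) ∞ L := L.toContinuousLinearMap.contMDiff
  have hdiff (p : M) (w : TangentSpace (𝓡 2) p) : diff (fun q => L (x q)) p w = L (diff x p w) :=
    diff_continuousLinearMap_comp ((hx p).mdifferentiableAt (by simp)) L.toContinuousLinearMap w
  refine ⟨⟨hLs.comp hx, fun p w hw => ?_⟩, ⟨hLs.comp hξ, fun p => ?_, fun p w => ?_⟩, ?_,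
    fun p => ?_⟩
  · rw [hdiff, hL]
    exact himm p w hw
  · rw [hL, hunit]
  · rw [hdiff, hL, horth]
  · rw [IsTimelike, hE3]
    norm_num
  · obtain ⟨-, -, hneg, hθ, hm⟩ := hang p
    have hpos := minkNorm_pos hU
    have hm' : mink (L (ξ p)) E3 = -Real.cosh θ := by
      apply mul_left_cancel₀ hpos.ne'
      rw [← mink_smul_right, ← hLU, hL, hm, minkNorm_of_unit (hunit p)]
      ring
    refine ⟨?_, ?_, ?_, hθ, ?_⟩
    · rw [IsTimelike, hL, hunit]
      norm_num
    · rw [IsTimelike, hE3]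
      norm_num
    · rw [hm']
      exact neg_neg_of_pos (Real.cosh_pos θ)
    · rw [hm', minkNorm_of_unit hE3, minkNorm_of_unit (by rw [hL, hunit])]
      ring

variable [IsManifold (𝓡 2) ∞ M]

/-- The second fundamental form vanishes where the derivative of the normal field does. -/
theorem isTotallyGeodesicAt_of_diff_eq_zero {x ξ : M → E31} (h : IsUnitNormalField x ξ) {p : M}
    (hp : ∀ w, diff ξ p w = 0) : IsTotallyGeodesicAt x ξ p := by
  intro X Y _ _
  have hξd : MDifferentiableAt (𝓡 2) 𝓘(ℝ, E31) ξ p := (h.1 p).mdifferentiableAt (by simp)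
  suffices hs : mink (ambientDeriv x X Y p) (ξ p) = 0 by
    simp [secondFundamentalForm, hs]
  set A : M → E31 := fun q => diff x q (Y q) with hA
  by_cases hAd : MDifferentiableAt (𝓡 2) 𝓘(ℝ, E31) A p
  · set φ := chartAt (EuclideanSpace ℝ (Fin 2)) p with hφ
    have hloc {f : M → E31} (hf : MDifferentiableAt (𝓡 2) 𝓘(ℝ, E31) f p) :
        DifferentiableAt ℝ (f ∘ φ.symm) (φ p) := by
      have hf' := ((mdifferentiableAt_iff _ _).1 hf).2
      rw [ModelWithCorners.range_eq_univ, differentiableWithinAt_univ] at hf'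
      exact hf'
    -- Differentiating `⟨dx Y, ξ⟩ = 0` gives `⟨D_X Y, ξ⟩ = -⟨dx Y, dξ X⟩`, which vanishes with `dξ`.
    have h0 : (fun z => mink ((A ∘ φ.symm) z) ((ξ ∘ φ.symm) z)) = fun _ => 0 := by
      funext z
      have := h.2.2 (φ.symm z) (Y (φ.symm z))
      simp only [mink] at this
      simp only [mink, hA, Function.comp]
      linarith
    obtain ⟨w, hAw, hξw⟩ : ∃ w : EuclideanSpace ℝ (Fin 2),
        fderiv ℝ (A ∘ φ.symm) (φ p) w = ambientDeriv x X Y p ∧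
        fderiv ℝ (ξ ∘ φ.symm) (φ p) w = 0 :=
      ⟨X p, (diff_apply_eq_fderiv hAd (X p)).symm,
        (diff_apply_eq_fderiv hξd (X p)).symm.trans (hp (X p))⟩
    have h1 := fderiv_mink (hloc hAd) (hloc hξd) w
    rw [h0, hAw, hξw] at h1
    simp only [Function.comp, φ.left_inv (mem_chart_source _ p)] at h1
    simpa [mink] using h1.symm
  -- Without differentiability `mfderiv` takes its default value 0.
  · have h0 : ambientDeriv x X Y p = 0 :=
      congrArg (fun L => L (X p)) (mfderiv_zero_of_not_mdifferentiableAt hAd)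
    simp [h0, mink]

/-- The local normal form of a constant angle surface with axis `E3`. -/
theorem exists_chart_param {x ξ : M → E31} {θ : ℝ} (h : IsConstantAngleSurface x ξ E3 θ)
    (hθ : 0 < θ) {p : M} (hp : ∃ w, diff ξ p w ≠ 0) :
    ∃ e ∈ IsManifold.maximalAtlas (𝓡 2) ∞ M, p ∈ e.source ∧
      ∃ (a b c d : ℝ) (α ψ₁ ψ₂ : ℝ → ℝ), e.target = rect a b c d ∧
        ContDiffOn ℝ ∞ α (Set.Ioo a b) ∧
        (∀ v ∈ Set.Ioo a b,
          HasDerivAt ψ₁ (Real.sinh θ * (α v * Real.sin v)) v ∧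
          HasDerivAt ψ₂ (Real.sinh θ * -(α v * Real.cos v)) v) ∧
        ∀ q ∈ e.source, x q = param θ ψ₁ ψ₂ (e q 0) (e q 1) := by
  obtain ⟨⟨hx, himm⟩, ⟨hξ, hunit, horth⟩, hU, hang⟩ := h
  have hE3 : mink E3 E3 = -1 := by simp [mink, E3]
  set φ := chartAt (EuclideanSpace ℝ (Fin 2)) p with hφ
  have hφm : φ ∈ IsManifold.maximalAtlas (𝓡 2) ∞ M := IsManifold.chart_mem_maximalAtlas p
  have hps : p ∈ φ.source := mem_chart_source _ p
  have hξ2 (q : M) : ξ q 2 = Real.cosh θ := by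
    have := (hang q).2.2.2.2
    rw [mink_E3, minkNorm_of_unit (hunit q), minkNorm_of_unit hE3] at this
    linarith
  obtain ⟨O, hOφ, hO, hpO, G, hG, hinj, hGeq⟩ := exists_height_angle φ.open_target
    (contDiffOn_comp_symm hφm hx) (contDiffOn_comp_symm hφm hξ) hθ
    (fun z _ => hunit (φ.symm z)) (fun z _ => hξ2 (φ.symm z))
    (fun z hz w => by
      obtain ⟨w', hw'⟩ := fderiv_comp_symm hφm hx hz w
      rw [hw']
      exact horth _ w')
    (φ.map_source hps)
    (fun w hw => by
      rw [← diff_apply_eq_fderiv ((hx p).mdifferentiableAt (by simp))]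
      exact himm p w hw)
    (fun h0 => by
      obtain ⟨w, hw⟩ := hp
      apply hw
      exact (diff_apply_eq_fderiv ((hξ p).mdifferentiableAt (by simp)) w).trans
        (congrArg (fun L => L w) h0))
  obtain ⟨ε, hεp, hεO, hεG, ⟨a, b, c, d, hεt⟩, hεd, hεd'⟩ :=
    exists_openPartialHomeomorph_rect hO hG hpO hinj
  have hεφ : ε.source ⊆ φ.target := hεO.trans hOφ
  let e : OpenPartialHomeomorph M (EuclideanSpace ℝ (Fin 2)) := φ.trans ε
  have hes : ∀ q ∈ e.source, q ∈ φ.source ∧ φ q ∈ ε.source := by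
    intro q hq
    simpa [e, OpenPartialHomeomorph.trans_source] using hq
  have het : e.target = rect a b c d := by
    rw [← hεt]
    ext y
    simp only [e, OpenPartialHomeomorph.trans_target, Set.mem_inter_iff, Set.mem_preimage,
      and_iff_left_iff_imp]
    exact fun hy => hεφ (ε.map_target hy)
  have he : e ∈ IsManifold.maximalAtlas (𝓡 2) ∞ M := by
    apply e.mem_maximalAtlas_of_contMDiffOn
    · exact (contMDiffOn_iff_contDiffOn.2 hεd).comp
        ((contMDiffOn_of_mem_maximalAtlas hφm).mono fun q hq => (hes q hq).1)
        fun q hq => (hes q hq).2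
    · refine (contMDiffOn_symm_of_mem_maximalAtlas hφm).comp
        ((contMDiffOn_iff_contDiffOn.2 hεd').mono ?_) ?_
      · rw [het, hεt]
      · rw [het, ← hεt]
        exact fun y hy => hεφ (ε.map_target hy)
  have hpe : p ∈ e.source := by
    simpa [e, OpenPartialHomeomorph.trans_source] using ⟨hps, hεp⟩
  have hcoord : ∀ q ∈ e.source,
      x q 2 = -(e q 0 * Real.sinh θ) ∧ ξ q = normalDir θ (e q 1) := by
    intro q hq
    have h1 := hGeq (φ q) (hεO (hes q hq).2)
    simp only [Function.comp, φ.left_inv (hes q hq).1, ← hεG] at h1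
    exact h1
  have hcd : c < d := by
    have h1 := e.map_source hpe
    rw [het] at h1
    exact h1.1.1.trans h1.1.2
  obtain ⟨α, ψ₁, ψ₂, hα, hψ, hY⟩ := exists_param (a := a) (b := b) hθ hcd (Y := x ∘ e.symm)
    (het ▸ contDiffOn_comp_symm he hx)
    (fun y hy => by
      rw [← het] at hy
      have h1 := (hcoord _ (e.map_target hy)).1
      rwa [e.right_inv hy] at h1)
    (fun y hy w => by
      rw [← het] at hy
      have h1 := (hcoord _ (e.map_target hy)).2
      rw [e.right_inv hy] at h1
      obtain ⟨w', hw'⟩ := fderiv_comp_symm he hx hy w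
      rw [hw', ← h1]
      exact horth _ w')
  refine ⟨e, he, hpe, a, b, c, d, α, ψ₁, ψ₂, het, hα, hψ, fun q hq => ?_⟩
  have h1 := hY (e q) (het ▸ e.map_source hq)
  rwa [Function.comp_apply, e.left_inv hq] at h1

end Surface

end Minkowski

open Minkowski in
theorem theorem3p3 {M : Type*} [TopologicalSpace M] [T2Space M]
    [ChartedSpace (EuclideanSpace ℝ (Fin 2)) M] [IsManifold (𝓡 2) ∞ M]
    (x ξ : M → E31) (U : E31) (θ : ℝ)
    (hM : IsConstantAngleSurface x ξ U θ) (hne : ¬ IsTotallyGeodesic x ξ) :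
    0 < θ ∧
    ∃ F : E31 →ᵃ[ℝ] E31, IsRigidMotion F ∧
      F.linear U = minkNorm U • E3 ∧
      IsConstantAngleSurface (fun q => F (x q)) (fun q => F.linear (ξ q)) E3 θ ∧
      ∀ p : M, ¬ IsTotallyGeodesicAt x ξ p →
        ∃ e ∈ IsManifold.maximalAtlas (𝓡 2) ∞ M, p ∈ e.source ∧
          ∃ (a b c d : ℝ) (α ψ₁ ψ₂ : ℝ → ℝ),
            e.target = {y | y 0 ∈ Set.Ioo c d ∧ y 1 ∈ Set.Ioo a b} ∧
            ContDiffOn ℝ ∞ α (Set.Ioo a b) ∧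
            (∀ v ∈ Set.Ioo a b,
              HasDerivAt ψ₁ (Real.sinh θ * (α v * Real.sin v)) v ∧
              HasDerivAt ψ₂ (Real.sinh θ * -(α v * Real.cos v)) v) ∧
            ∀ q ∈ e.source, F (x q) = param θ ψ₁ ψ₂ (e q 0) (e q 1) := by
  have hξ := hM.2.1
  have hang := hM.2.2.2
  have hpoint : ∀ p, ¬ IsTotallyGeodesicAt x ξ p → ∃ w, diff ξ p w ≠ 0 := by
    intro p hp
    by_contra! h
    exact hp (isTotallyGeodesicAt_of_diff_eq_zero hξ h)
  have hθ : 0 < θ := by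
    rw [IsTotallyGeodesic, not_forall] at hne
    obtain ⟨p, hp⟩ := hne
    refine lt_of_le_of_ne (hang p).2.2.2.1 fun h0 => ?_
    obtain ⟨w, hw⟩ := hpoint p hp
    subst h0
    -- At angle zero the normal is the constant vector `U / |U|`, contradicting `dξ ≠ 0` at `p`.
    have hconst : ξ = fun _ => (minkNorm U)⁻¹ • U :=
      funext fun q => eq_smul_of_isHyperbolicAngle_zero (hξ.2.1 q) (hang q)
    apply hw
    rw [hconst, diff, mfderiv_const]
    rfl
  obtain ⟨L, hL, hdet, hLU⟩ := exists_isometry hM.2.2.1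
  have hLM := hM.isometry_comp hL hLU
  refine ⟨hθ, L.toAffineMap, ⟨hL, hdet⟩, hLU, hLM, fun p hp => ?_⟩
  obtain ⟨w, hw⟩ := hpoint p hp
  -- The derivative of `L ∘ ξ` is `L` applied to that of `ξ`, so by injectivity of `L` it is still
  -- nonzero on `w`.
  refine exists_chart_param hLM hθ ⟨w, fun h0 => hw (injective_of_mink hL ?_)⟩
  have h1 := diff_continuousLinearMap_comp ((hξ.1 p).mdifferentiableAt (by simp))
    L.toContinuousLinearMap w
  rw [map_zero, ← h0]
  exact h1.symm
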